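/- Let $N\in\mathbb{N}$, let $\Omega\subset\mathbb{R}^N$ be a bounded domain with boundary $\Gamma=\partial\Omega$, and let $\Gamma_t\neq\emptyset$ be a relatively open subset of $\Gamma$. Assume: (a) every point of $\Gamma_t$ has an open neighbourhood in $\mathbb{R}^N$ which is mapped by a bi-Lipschitz homeomorphism onto an open subset of $\mathbb{R}^N$ such that the points of $\Omega$ are exactly those mapped into an open half space $\{y_i>0\}$ (in particular this holds if $\Omega$ has Lipschitz boundary); (b) $(\Omega,\Gamma_t)$ is sliceable: there are finitely many pairwise disjoint, open, simply connected subdomains $\Omega_1,\dots,\Omega_J\subset\Omega$ such that $\Omega\setminus(\Omega_1\cup\dots\cup\Omega_J)$ is a Lebesgue null set and, for every $j$, the set $\overline{\Omega_j}\cap\Gamma_t$ has non-empty interior relative to $\Gamma$ and $\Omega_j$ has the Korn property, that is, the embedding $H^1(\Omega_j)\hookrightarrow L^2(\Omega_j)$ is compact and there is $c>0$ with $c\,\|\mathrm{Grad}\,v\|_{L^2(\Omega_j)}\le\|v\|_{L^2(\Omega_j)}+\|\mathrm{sym}\,\mathrm{Grad}\,v\|_{L^2(\Omega_j)}$ for all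 $v\in H^1(\Omega_j;\mathbb{R}^N)$. Here $\mathrm{Grad}\,v$ is the weak Jacobian of $v$, with rows $(\nabla v_n)^{\top}$, and $\mathrm{sym}\,T=\frac12(T+T^{\top})$. For a vector field $E$ let $\mathrm{curl}\,E=(\partial_iE_j-\partial_jE_i)_{i<j}$ (in the weak sense), and let $H(\mathrm{curl};\Omega)=\{E\in L^2(\Omega;\mathbb{R}^N):\mathrm{curl}\,E\in L^2(\Omega)\}$ with the graph norm. Let $\mathring H(\mathrm{curl};\Gamma_t,\Omega)$ be the closure in $H(\mathrm{curl};\Omega)$ of the set of restrictions $E|_\Omega$ of fields $E\in C^\infty_c(\mathbb{R}^N;\mathbb{R}^N)$ such that $\mathrm{dist}(\mathrm{supp}(E|_\Omega),\Gamma_t)>0$. Let $\mathring H(\mathrm{Curl}_0;\Gamma_t,\Omega)$ be the set of $(N\times N)$-tensor fields all of whose rows belong to $\mathring H(\mathrm{curl};\Gamma_t,\Omega)$ and have vanishing curl. Then for every $c_{k,s}>0$ (in particular for the constant of the standard first Korn inequality on $\Omega$) there is a constant $c_{k,t}\ge c_{k,s}$ such that $$\|\mathrm{Grad}\,v\|_{L^2(\Omega)}\le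 c_{k,t}\,\|\mathrm{sym}\,\mathrm{Grad}\,v\|_{L^2(\Omega)}$$ for all $v\in H^1(\Omega;\mathbb{R}^N)$ with $\mathrm{Grad}\,v\in\mathring H(\mathrm{Curl}_0;\Gamma_t,\Omega)$. (In classical terms the last condition says that every $\nabla v_n$, $n=1,\dots,N$, is normal at $\Gamma_t$.) -/

import Mathlib

open MeasureTheory Set Filter Topology
open scoped ContDiff

namespace KornTangential

noncomputable section

/-- Euclidean space `ℝ^N`. -/
abbrev Vec (N : ℕ) := EuclideanSpace ℝ (Fin N)

/-- `(N × N)`-matrices, the values of tensor fields. -/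
abbrev Ten (N : ℕ) := Matrix (Fin N) (Fin N) ℝ

/-- The index set of the `N(N-1)/2` components of the rotation of a vector field. -/
abbrev RotIdx (N : ℕ) := {p : Fin N × Fin N // p.1 < p.2}

variable {N : ℕ}

/-! ### Square-integrable fields -/

/-- All components of the field `f` are square-integrable on `Ω`. -/
def MemL2 {ι : Type} (Ω : Set (Vec N)) (f : Vec N → ι → ℝ) : Prop :=
  ∀ k, MemLp (fun x => f x k) 2 (volume.restrict Ω)

/-- The `L²(Ω)`-norm of a field, for the Euclidean norm on its values. -/
def l2Norm {ι : Type} [Fintype ι] (Ω : Set (Vec N)) (f : Vec N → ι → ℝ) : ℝ :=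
  Real.sqrt (∫ x in Ω, ∑ k, f x k ^ 2)

/-- A scalar function, viewed as a field with a single component. -/
def scalar (u : Vec N → ℝ) : Vec N → Unit → ℝ := fun x _ => u x

/-- A tensor field, viewed as a field with `N * N` components; its `l2Norm` is the `L²`-norm for the
Frobenius norm of matrices. -/
def entries (T : Vec N → Ten N) : Vec N → Fin N × Fin N → ℝ := fun x p => T x p.1 p.2

/-- The `n`-th row of a tensor field. -/
def row (T : Vec N → Ten N) (n : Fin N) : Vec N → Fin N → ℝ := fun x => T x n

/-- The symmetric part of a tensor field. -/
def symPart (T : Vec N → Ten N) : Vec N → Ten N :=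
  fun x => (1 / 2 : ℝ) • (T x + (T x).transpose)

/-! ### Weak derivatives and Sobolev spaces -/

/-- The classical partial derivative `∂ᵢ f`. -/
def pderiv (i : Fin N) (f : Vec N → ℝ) (x : Vec N) : ℝ :=
  fderiv ℝ f x (EuclideanSpace.single i 1)

/-- Smooth functions with compact support contained in `Ω`. -/
def IsTestFunction (Ω : Set (Vec N)) (φ : Vec N → ℝ) : Prop :=
  ContDiff ℝ ∞ φ ∧ HasCompactSupport φ ∧ tsupport φ ⊆ Ω

/-- `u ∈ H¹(Ω)`, with weak gradient `g`. -/
structure IsH1 (Ω : Set (Vec N)) (u : Vec N → ℝ) (g : Vec N → Fin N → ℝ) : Prop where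
  memL2 : MemL2 Ω (scalar u)
  grad_memL2 : MemL2 Ω g
  weak_grad : ∀ i, ∀ φ, IsTestFunction Ω φ →
    ∫ x in Ω, u x * pderiv i φ x = -∫ x in Ω, g x i * φ x

/-- `v ∈ H¹(Ω; ℝ^N)`, with weak Jacobian `Grad v = G` (the rows of `G` are the weak gradients of the
components of `v`). -/
def IsH1Vec (Ω : Set (Vec N)) (v : Vec N → Fin N → ℝ) (G : Vec N → Ten N) : Prop :=
  ∀ n, IsH1 Ω (fun x => v x n) (row G n)

/-- The classical rotation, with components `∂ᵢ Eⱼ - ∂ⱼ Eᵢ` for `i < j`. -/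
def curl (E : Vec N → Fin N → ℝ) : Vec N → RotIdx N → ℝ :=
  fun x p => pderiv p.1.1 (fun y => E y p.1.2) x - pderiv p.1.2 (fun y => E y p.1.1) x

/-- `E ∈ H(curl; Ω)`, with weak rotation `C`. -/
structure IsHcurl (Ω : Set (Vec N)) (E : Vec N → Fin N → ℝ) (C : Vec N → RotIdx N → ℝ) :
    Prop where
  memL2 : MemL2 Ω E
  curl_memL2 : MemL2 Ω C
  weak_curl : ∀ p : RotIdx N, ∀ φ, IsTestFunction Ω φ →
    ∫ x in Ω, (E x p.1.2 * pderiv p.1.1 φ x - E x p.1.1 * pderiv p.1.2 φ x)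
      = -∫ x in Ω, C x p * φ x

/-- The vector fields whose restriction to `Ω` belongs to the test space `C̊^∞(Γt, Ω)`:
smooth compactly supported fields on `ℝ^N` such that the support of their restriction to `Ω` has
positive distance from `Γt`. -/
structure IsBdryTestField (Ω Γt : Set (Vec N)) (Ψ : Vec N → Fin N → ℝ) : Prop where
  smooth : ContDiff ℝ ∞ Ψ
  compact : HasCompactSupport Ψ
  away : ∃ δ > 0, ∀ x ∈ Ω, Ψ x ≠ 0 → ∀ y ∈ Γt, δ ≤ dist x y

/-- `E ∈ H̊(curl; Γt, Ω)`, with weak rotation `C`: the closure of the test space `C̊^∞(Γt, Ω)` in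
`H(curl; Ω)`. -/
def IsHcurlCirc (Ω Γt : Set (Vec N)) (E : Vec N → Fin N → ℝ) (C : Vec N → RotIdx N → ℝ) :
    Prop :=
  IsHcurl Ω E C ∧
    ∀ ε > 0, ∃ Ψ, IsBdryTestField Ω Γt Ψ ∧
      l2Norm Ω (fun x => E x - Ψ x) < ε ∧ l2Norm Ω (fun x => C x - curl Ψ x) < ε

/-- `T ∈ H̊(Curl₀; Γt, Ω)`: every row of `T` belongs to `H̊(curl; Γt, Ω)` and has vanishing weak
rotation. -/
def IsHCurlZeroCirc (Ω Γt : Set (Vec N)) (T : Vec N → Ten N) : Prop :=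
  ∀ n, IsHcurlCirc Ω Γt (row T n) 0

/-! ### Assumptions on the domain and its boundary part -/

/-- Bounded domains (non-empty, open, connected). -/
def IsBoundedDomain (Ω : Set (Vec N)) : Prop :=
  IsOpen Ω ∧ IsConnected Ω ∧ Bornology.IsBounded Ω

/-- The Korn property: Korn's second inequality holds on `Ω`, and the embedding of `H¹(Ω)` into
`L²(Ω)` is compact. -/
structure KornProperty (Ω : Set (Vec N)) : Prop where
  second_korn : ∃ c > 0, ∀ v G, IsH1Vec Ω v G →
    c * l2Norm Ω (entries G) ≤ l2Norm Ω v + l2Norm Ω (entries (symPart G))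
  rellich : ∀ (u : ℕ → Vec N → ℝ) (g : ℕ → Vec N → Fin N → ℝ) (M : ℝ),
    (∀ k, IsH1 Ω (u k) (g k) ∧ l2Norm Ω (scalar (u k)) ≤ M ∧ l2Norm Ω (g k) ≤ M) →
    ∃ (w : Vec N → ℝ) (s : ℕ → ℕ), MemL2 Ω (scalar w) ∧ StrictMono s ∧
      Tendsto (fun k => l2Norm Ω (scalar fun x => u (s k) x - w x)) atTop (𝓝 0)

/-- `Γt` is a relatively open subset of the boundary of `Ω`. -/
def IsRelOpenBdry (Ω Γt : Set (Vec N)) : Prop :=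
  ∃ U, IsOpen U ∧ Γt = U ∩ frontier Ω

/-- The interior of `A` with respect to the topology of the boundary of `Ω`. -/
def relInterior (Ω A : Set (Vec N)) : Set (Vec N) :=
  {x | x ∈ frontier Ω ∧ ∃ U, IsOpen U ∧ x ∈ U ∧ U ∩ frontier Ω ⊆ A}

/-- The pair `(Ω, Γt)` is sliceable: up to a null set, `Ω` is the union of finitely many disjoint
simply connected subdomains with the Korn property, the boundary of each of which contains a
relatively open part of `Γt`. (`SimplyConnectedSpace` includes that the space is non-empty and
path-connected.) -/
def Sliceable (Ω Γt : Set (Vec N)) : Prop :=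
  ∃ (J : ℕ) (P : Fin J → Set (Vec N)),
    (∀ j, P j ⊆ Ω) ∧
    volume (Ω \ ⋃ j, P j) = 0 ∧
    Pairwise (fun i j => Disjoint (P i) (P j)) ∧
    ∀ j, IsOpen (P j) ∧ SimplyConnectedSpace (P j) ∧ KornProperty (P j) ∧
      (Γt.Nonempty → (relInterior Ω (closure (P j) ∩ Γt)).Nonempty)

/-- `Ω` is (weakly) Lipschitz near `x`: some bi-Lipschitz homeomorphism from an open neighbourhood
of `x` onto an open subset of `ℝ^N` maps the part inside `Ω` to the part of positive `i`-th
coordinate, and the part outside `Ω` to the part of non-positive `i`-th coordinate. -/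
def HasLipschitzChartAt (Ω : Set (Vec N)) (x : Vec N) : Prop :=
  ∃ (e : OpenPartialHomeomorph (Vec N) (Vec N)) (K : NNReal) (i : Fin N),
    x ∈ e.source ∧ LipschitzOnWith K e e.source ∧ LipschitzOnWith K e.symm e.target ∧
      ∀ y ∈ e.source, y ∈ Ω ↔ 0 < e y i

end

end KornTangential

open KornTangential

/-! The proof is by contradiction and compactness. If no constant worked, there would be Jacobians
`T k` of unit norm with the boundary condition and with symmetric parts tending to zero.

Compactness is available only on the pieces of the slicing. On each piece, constants are subtracted
from the displacement components so that Poincaré's inequality (`exists_poincare`, itself a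
consequence of Rellich) bounds them in L². Rellich then gives a subsequence along which they are
Cauchy, and Korn's second inequality, applied to differences, makes the Jacobians Cauchy
(`exists_cauchyL2_subsequence`). Since the pieces fill `Ω` up to a null set, a common subsequence
converges in L²(Ω) to some F (`cauchyL2_of_pieces`).

The boundary condition enters only in weak form: the extension of each row by zero is irrotational
across `Γt` (`IsCurlFreeAcross`), a property stable under L² limits. Hence F is skew with
irrotational rows, so all its weak derivatives vanish and F is a constant skew matrix A on the
connected set `Ω`. Near a chart point of `Γt` the indicator of `Ω` is not locally constant, so some
b = ∫_Ω ∇φ, a smeared normal, is non-zero, and every row of A is parallel to b. A skew matrix of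
rank at most one is zero (`l2Norm_entries_eq_zero`), whereas F has norm one. -/

namespace KornTangential

variable {N : ℕ} {ι : Type} {Ω : Set (Vec N)}

/-! ### The L² norm of fields, Cauchy sequences and subsequences. -/

section L2

theorem MemL2.sub {f g : Vec N → ι → ℝ} (hf : MemL2 Ω f) (hg : MemL2 Ω g) :
    MemL2 Ω (fun x => f x - g x) := fun k => (hf k).sub (hg k)

theorem MemL2.const_smul {f : Vec N → ι → ℝ} (hf : MemL2 Ω f) (c : ℝ) :
    MemL2 Ω (fun x => c • f x) := fun k => (hf k).const_mul c

theorem MemL2.mono {Ω' : Set (Vec N)} (h : Ω' ⊆ Ω) {f : Vec N → ι → ℝ} (hf : MemL2 Ω f) :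
    MemL2 Ω' f := fun k => (hf k).mono_measure (Measure.restrict_mono h le_rfl)

variable [Fintype ι]

theorem MemL2.memLp {f : Vec N → ι → ℝ} (hf : MemL2 Ω f) :
    MemLp (fun x => (WithLp.toLp 2 (f x) : EuclideanSpace ℝ ι)) 2 (volume.restrict Ω) :=
  MemLp.of_eval_piLp hf

/-- A square-integrable field as an element of the Hilbert space `L²`. -/
noncomputable def MemL2.toL2 {f : Vec N → ι → ℝ} (hf : MemL2 Ω f) :
    Lp (EuclideanSpace ℝ ι) 2 (volume.restrict Ω) := hf.memLp.toLp _

/-- Through this isometry the triangle inequality, Cauchy-Schwarz and completeness are inherited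
from the Hilbert space `Lp`. -/
theorem MemL2.norm_toL2 {f : Vec N → ι → ℝ} (hf : MemL2 Ω f) : ‖hf.toL2‖ = l2Norm Ω f := by
  rw [MemL2.toL2, Lp.norm_toLp,
    MemLp.eLpNorm_eq_integral_rpow_norm (by norm_num) (by norm_num) hf.memLp,
    ENNReal.toReal_ofReal (by positivity), l2Norm, Real.sqrt_eq_rpow]
  simp [EuclideanSpace.norm_sq_eq]

theorem MemL2.toL2_sub {f g : Vec N → ι → ℝ} (hf : MemL2 Ω f) (hg : MemL2 Ω g) :
    (hf.sub hg).toL2 = hf.toL2 - hg.toL2 := rfl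

theorem l2Norm_nonneg (f : Vec N → ι → ℝ) : 0 ≤ l2Norm Ω f := Real.sqrt_nonneg _

theorem l2Norm_const_smul (c : ℝ) (f : Vec N → ι → ℝ) :
    l2Norm Ω (fun x => c • f x) = |c| * l2Norm Ω f := by
  simp only [l2Norm, Pi.smul_apply, smul_eq_mul, mul_pow, ← Finset.mul_sum]
  rw [integral_const_mul, Real.sqrt_mul (sq_nonneg c), Real.sqrt_sq_eq_abs]

theorem l2Norm_sub_le {f g h : Vec N → ι → ℝ} (hf : MemL2 Ω f) (hg : MemL2 Ω g)
    (hh : MemL2 Ω h) :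
    l2Norm Ω (fun x => f x - h x) ≤ l2Norm Ω (fun x => f x - g x) +
      l2Norm Ω (fun x => g x - h x) := by
  simpa only [← MemL2.toL2_sub, MemL2.norm_toL2] using
    norm_sub_le_norm_sub_add_norm_sub hf.toL2 hg.toL2 hh.toL2

theorem abs_l2Norm_sub_le {f g : Vec N → ι → ℝ} (hf : MemL2 Ω f) (hg : MemL2 Ω g) :
    |l2Norm Ω f - l2Norm Ω g| ≤ l2Norm Ω (fun x => f x - g x) := by
  rw [← (hf.sub hg).norm_toL2, ← hf.norm_toL2, ← hg.norm_toL2, MemL2.toL2_sub]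
  exact abs_norm_sub_norm_le _ _

theorem l2Norm_sub_le_add {f g : Vec N → ι → ℝ} (hf : MemL2 Ω f) (hg : MemL2 Ω g) :
    l2Norm Ω (fun x => f x - g x) ≤ l2Norm Ω f + l2Norm Ω g := by
  rw [← (hf.sub hg).norm_toL2, ← hf.norm_toL2, ← hg.norm_toL2, MemL2.toL2_sub]
  exact norm_sub_le _ _

theorem l2Norm_sub_comm (f g : Vec N → ι → ℝ) :
    l2Norm Ω (fun x => f x - g x) = l2Norm Ω (fun x => g x - f x) := by
  simp only [l2Norm, Pi.sub_apply]
  simp_rw [sub_sq_comm]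

theorem MemL2.integrable_sq {f : Vec N → ι → ℝ} (hf : MemL2 Ω f) :
    IntegrableOn (fun x => ∑ k, f x k ^ 2) Ω :=
  integrable_finsetSum _ fun k _ => (hf k).integrable_sq

theorem l2Norm_le_of_forall {κ : Type} [Fintype κ] {f : Vec N → ι → ℝ} {g : Vec N → κ → ℝ}
    (hg : MemL2 Ω g) (h : ∀ x, ∑ k, f x k ^ 2 ≤ ∑ k, g x k ^ 2) :
    l2Norm Ω f ≤ l2Norm Ω g :=
  Real.sqrt_le_sqrt (integral_mono_of_nonneg (ae_of_all _ fun x => by positivity)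
    hg.integrable_sq (ae_of_all _ h))

theorem l2Norm_scalar_le {f : Vec N → ι → ℝ} (hf : MemL2 Ω f) (k : ι) :
    l2Norm Ω (scalar fun x => f x k) ≤ l2Norm Ω f :=
  l2Norm_le_of_forall hf fun x => by
    simpa [scalar] using Finset.single_le_sum (f := fun k => f x k ^ 2)
      (fun i _ => sq_nonneg _) (Finset.mem_univ k)

theorem l2Norm_sq (f : Vec N → ι → ℝ) : l2Norm Ω f ^ 2 = ∫ x in Ω, ∑ k, f x k ^ 2 :=
  Real.sq_sqrt (integral_nonneg fun x => by positivity)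

theorem l2Norm_le_sum {f : Vec N → ι → ℝ} (hf : MemL2 Ω f) :
    l2Norm Ω f ≤ ∑ k, l2Norm Ω (scalar fun x => f x k) := by
  refine abs_le_of_sq_le_sq' ?_ (Finset.sum_nonneg fun k _ => l2Norm_nonneg _) |>.2
  rw [l2Norm_sq, integral_finsetSum _ fun k _ => (hf k).integrable_sq]
  refine le_trans (le_of_eq ?_) (Finset.sum_sq_le_sq_sum_of_nonneg fun k _ => l2Norm_nonneg _)
  refine Finset.sum_congr rfl fun k _ => ?_
  rw [l2Norm_sq]
  simp [scalar]

theorem l2Norm_mono_set {Ω' : Set (Vec N)} (h : Ω' ⊆ Ω) {f : Vec N → ι → ℝ} (hf : MemL2 Ω f) :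
    l2Norm Ω' f ≤ l2Norm Ω f :=
  Real.sqrt_le_sqrt (setIntegral_mono_set hf.integrable_sq
    (ae_of_all _ fun x => by positivity) h.eventuallyLE)

/-- Cauchy-Schwarz inequality. -/
theorem abs_integral_mul_le {f g : Vec N → ℝ} (hf : MemLp f 2 (volume.restrict Ω))
    (hg : MemLp g 2 (volume.restrict Ω)) :
    |∫ x in Ω, f x * g x| ≤ l2Norm Ω (scalar f) * l2Norm Ω (scalar g) := by
  have hf' : MemL2 Ω (scalar f) := fun _ => hf
  have hg' : MemL2 Ω (scalar g) := fun _ => hg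
  have key : inner ℝ hg'.toL2 hf'.toL2 = ∫ x in Ω, f x * g x := by
    rw [L2.inner_def]
    refine integral_congr_ae ?_
    filter_upwards [hf'.memLp.coeFn_toLp, hg'.memLp.coeFn_toLp] with x hx hy
    rw [MemL2.toL2, MemL2.toL2, hx, hy]
    simp [scalar, PiLp.inner_apply]
  rw [← key, ← hf'.norm_toL2, ← hg'.norm_toL2, mul_comm]
  exact abs_real_inner_le_norm _ _

theorem l2Norm_eq_zero_iff {f : Vec N → ι → ℝ} (hf : MemL2 Ω f) :
    l2Norm Ω f = 0 ↔ ∀ᵐ x ∂volume.restrict Ω, f x = 0 := by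
  rw [← hf.norm_toL2, norm_eq_zero, Lp.eq_zero_iff_ae_eq_zero]
  have hae : hf.toL2 =ᵐ[volume.restrict Ω] fun x => WithLp.toLp 2 (f x) := hf.memLp.coeFn_toLp
  refine ⟨fun h => ?_, fun h => ?_⟩ <;> filter_upwards [h, hae] with x hx hx'
  · rw [hx] at hx'
    simpa using congrArg WithLp.ofLp hx'.symm
  · simp [hx', hx]

/-- Cauchy sequences with respect to `l2Norm`. -/
def CauchyL2 (Ω : Set (Vec N)) (f : ℕ → Vec N → ι → ℝ) : Prop :=
  ∀ ε > 0, ∃ K, ∀ k ≥ K, ∀ l ≥ K, l2Norm Ω (fun x => f k x - f l x) < ε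

theorem CauchyL2.comp_strictMono {f : ℕ → Vec N → ι → ℝ} (h : CauchyL2 Ω f) {s : ℕ → ℕ}
    (hs : StrictMono s) : CauchyL2 Ω (fun k => f (s k)) := fun ε hε => by
  obtain ⟨K, hK⟩ := h ε hε
  exact ⟨K, fun k hk l hl => hK _ (hk.trans hs.le_apply) _ (hl.trans hs.le_apply)⟩

theorem CauchyL2.exists_tendsto {f : ℕ → Vec N → ι → ℝ} (h : CauchyL2 Ω f)
    (hf : ∀ k, MemL2 Ω (f k)) :
    ∃ g, MemL2 Ω g ∧ Tendsto (fun k => l2Norm Ω (fun x => f k x - g x)) atTop (𝓝 0) := by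
  have hc : CauchySeq fun k => (hf k).toL2 := by
    rw [Metric.cauchySeq_iff]
    intro ε hε
    obtain ⟨K, hK⟩ := h ε hε
    refine ⟨K, fun k hk l hl => ?_⟩
    rw [dist_eq_norm, ← MemL2.toL2_sub, MemL2.norm_toL2]
    exact hK k hk l hl
  obtain ⟨F, hF⟩ := cauchySeq_tendsto_of_complete hc
  have hFm : MemL2 Ω (fun x => WithLp.ofLp (F x)) := MemLp.eval_piLp (Lp.memLp F)
  have hFe : hFm.toL2 = F := Lp.toLp_coeFn F (Lp.memLp F)
  refine ⟨_, hFm, ?_⟩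
  rw [tendsto_iff_norm_sub_tendsto_zero, ← hFe] at hF
  refine hF.congr fun k => ?_
  rw [← MemL2.toL2_sub, MemL2.norm_toL2]

theorem cauchyL2_of_tendsto {f : ℕ → Vec N → ι → ℝ} {g : Vec N → ι → ℝ}
    (hf : ∀ k, MemL2 Ω (f k)) (hg : MemL2 Ω g)
    (h : Tendsto (fun k => l2Norm Ω (fun x => f k x - g x)) atTop (𝓝 0)) : CauchyL2 Ω f := by
  intro ε hε
  obtain ⟨K, hK⟩ := eventually_atTop.1 (h.eventually (gt_mem_nhds (half_pos hε)))
  refine ⟨K, fun k hk l hl => ?_⟩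
  have h1 := l2Norm_sub_le (hf k) hg (hf l)
  rw [l2Norm_sub_comm g] at h1
  linarith [hK k hk, hK l hl]

theorem tendsto_integral_mul {f : ℕ → Vec N → ℝ} {g h : Vec N → ℝ}
    (hf : ∀ k, MemLp (f k) 2 (volume.restrict Ω)) (hg : MemLp g 2 (volume.restrict Ω))
    (hh : MemLp h 2 (volume.restrict Ω))
    (hlim : Tendsto (fun k => l2Norm Ω (scalar fun x => f k x - g x)) atTop (𝓝 0)) :
    Tendsto (fun k => ∫ x in Ω, f k x * h x) atTop (𝓝 (∫ x in Ω, g x * h x)) := by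
  rw [tendsto_iff_norm_sub_tendsto_zero]
  refine squeeze_zero (fun _ => norm_nonneg _) (fun k => ?_)
    (by simpa using hlim.mul_const (l2Norm Ω (scalar h)))
  have : (∫ x in Ω, f k x * h x) - ∫ x in Ω, g x * h x = ∫ x in Ω, (f k x - g x) * h x := by
    simp_rw [sub_mul]
    exact (integral_sub ((hf k).integrable_mul hh) (hg.integrable_mul hh)).symm
  rw [this, Real.norm_eq_abs]
  exact abs_integral_mul_le ((hf k).sub hg) hh

/-- Finitely many properties of sequences that are inherited by subsequences, and that hold along
a subsequence of any given sequence, hold along a common subsequence. -/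
theorem exists_common_subsequence {κ : Type} [Finite κ] (Q : κ → (ℕ → ℕ) → Prop)
    (hsub : ∀ i s (t : ℕ → ℕ), StrictMono t → Q i s → Q i (s ∘ t))
    (hex : ∀ i s, StrictMono s → ∃ t : ℕ → ℕ, StrictMono t ∧ Q i (s ∘ t)) :
    ∃ s : ℕ → ℕ, StrictMono s ∧ ∀ i, Q i s := by
  have := Fintype.ofFinite κ
  classical
  suffices h : ∀ I : Finset κ, ∃ s : ℕ → ℕ, StrictMono s ∧ ∀ i ∈ I, Q i s by simpa using h Finset.univ
  intro I
  induction I using Finset.induction_on with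
  | empty => exact ⟨id, strictMono_id, by simp⟩
  | insert i I _ ih =>
    obtain ⟨s, hs, h⟩ := ih
    obtain ⟨t, ht, hi⟩ := hex i s hs
    refine ⟨s ∘ t, hs.comp ht, fun j hj => ?_⟩
    rcases Finset.mem_insert.1 hj with rfl | hj
    · exact hi
    · exact hsub _ _ _ ht (h j hj)

end L2

/-! ### Functions with vanishing weak gradient are constant. -/

section WeaklyConstant

open scoped Convolution

theorem IsTestFunction.mono {Ω' : Set (Vec N)} (h : Ω' ⊆ Ω) {φ : Vec N → ℝ}
    (hφ : IsTestFunction Ω' φ) : IsTestFunction Ω φ :=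
  ⟨hφ.1, hφ.2.1, hφ.2.2.trans h⟩

theorem continuous_pderiv {φ : Vec N → ℝ} (hφ : ContDiff ℝ ∞ φ) (i : Fin N) :
    Continuous (pderiv i φ) :=
  (hφ.continuous_fderiv (by simp)).clm_apply continuous_const

theorem pderiv_eq_zero_of_notMem {φ : Vec N → ℝ} {x : Vec N} (hx : x ∉ tsupport φ) (i : Fin N) :
    pderiv i φ x = 0 := by
  have : fderiv ℝ φ x = 0 := by
    by_contra h
    exact hx (support_fderiv_subset ℝ h)
  simp [pderiv, this]

theorem hasCompactSupport_pderiv {φ : Vec N → ℝ} (hφ : HasCompactSupport φ) (i : Fin N) :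
    HasCompactSupport (pderiv i φ) :=
  hφ.fderiv_apply ℝ _

theorem IsTestFunction.memLp {φ : Vec N → ℝ} (hφ : IsTestFunction Ω φ) (μ : Measure (Vec N))
    [IsFiniteMeasureOnCompacts μ] : MemLp φ 2 μ :=
  hφ.1.continuous.memLp_of_hasCompactSupport hφ.2.1

theorem IsTestFunction.memLp_pderiv {φ : Vec N → ℝ} (hφ : IsTestFunction Ω φ) (i : Fin N)
    (μ : Measure (Vec N)) [IsFiniteMeasureOnCompacts μ] : MemLp (pderiv i φ) 2 μ :=
  (continuous_pderiv hφ.1 i).memLp_of_hasCompactSupport (hasCompactSupport_pderiv hφ.2.1 i)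

/-- A function all of whose weak partial derivatives vanish on `Ω` is almost everywhere constant
on balls that are relatively small in `Ω`. -/
theorem ae_eq_const_on_ball {u : Vec N → ℝ} {x : Vec N} {r : ℝ} (hr : 0 < r)
    (hball : Metric.ball x (2 * r) ⊆ Ω) (hu : IntegrableOn u (Metric.ball x (2 * r)))
    (hweak : ∀ i, ∀ φ, IsTestFunction Ω φ → ∫ y in Ω, u y * pderiv i φ y = 0) :
    ∃ c, ∀ᵐ y ∂volume.restrict (Metric.ball x r), u y = c := by
  -- The cut-off makes the function integrable on the whole space, so that it can be mollified; the
  -- mollifications turn out to be constant on the smaller ball.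
  set w : Vec N → ℝ := (Metric.ball x (2 * r)).indicator u with hw
  have hwint : Integrable w := hu.integrable_indicator measurableSet_ball
  have hwloc : LocallyIntegrable w := hwint.locallyIntegrable
  -- Outer radii at most r keep ρ(z - ·) supported inside the ball of radius 2r when z is in the
  -- ball of radius r. The fixed ratio 2 of the radii is what almost everywhere convergence
  -- requires.
  let ρ : ℕ → ContDiffBump (0 : Vec N) := fun k =>
    ⟨r / 2 / (k + 1), r / (k + 1), by positivity, by gcongr; linarith⟩
  have hρle : ∀ k, (ρ k).rOut ≤ r := fun k => by
    show r / ((k : ℝ) + 1) ≤ r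
    exact div_le_self hr.le (by linarith [(Nat.cast_nonneg k : (0 : ℝ) ≤ k)])
  have hlim := ContDiffBump.ae_convolution_tendsto_right_of_locallyIntegrable
    (φ := ρ) (l := atTop) (K := 2) (μ := (volume : Measure (Vec N))) (g := w)
    (by
      show Tendsto (fun k : ℕ => r / ((k : ℝ) + 1)) atTop (𝓝 0)
      exact tendsto_const_nhds.div_atTop (tendsto_natCast_atTop_atTop.atTop_add tendsto_const_nhds))
    (Eventually.of_forall fun k => by
      show r / ((k : ℝ) + 1) ≤ 2 * (r / 2 / (k + 1))
      exact le_of_eq (by field_simp)) hwloc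
  have hderiv : ∀ k, ∀ z ∈ Metric.ball x r,
      HasFDerivAt ((ρ k).normed volume ⋆[ContinuousLinearMap.lsmul ℝ ℝ, volume] w)
        (0 : Vec N →L[ℝ] ℝ) z := by
    intro k z hz
    have hsm : ContDiff ℝ ∞ ((ρ k).normed (volume : Measure (Vec N))) := (ρ k).contDiff_normed
    have hcs : HasCompactSupport ((ρ k).normed (volume : Measure (Vec N))) :=
      (ρ k).hasCompactSupport_normed
    have h := hcs.hasFDerivAt_convolution_left (𝕜 := ℝ) (ContinuousLinearMap.lsmul ℝ ℝ)
      (hsm.of_le (by simp)) hwloc z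
    refine HasFDerivAt.congr_fderiv h ?_
    have hex : ConvolutionExistsAt (fderiv ℝ ((ρ k).normed (volume : Measure (Vec N)))) w z
        (ContinuousLinearMap.precompL (Vec N) (ContinuousLinearMap.lsmul ℝ ℝ)) volume :=
      (hcs.fderiv ℝ).convolutionExists_left _ (hsm.continuous_fderiv (by simp)) hwloc z
    apply ContinuousLinearMap.coe_injective
    refine (EuclideanSpace.basisFun (Fin N) ℝ).toBasis.ext fun i => ?_
    simp only [ContinuousLinearMap.coe_coe, OrthonormalBasis.coe_toBasis,
      EuclideanSpace.basisFun_apply, ContinuousLinearMap.toLinearMap_zero, LinearMap.zero_apply]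
    rw [convolution_def, ContinuousLinearMap.integral_apply hex]
    -- The derivative of the mollification at z falls on the kernel, and the reflected kernel ψ is
    -- an admissible test function: the derivative is an instance of the weak hypothesis.
    let ψ : Vec N → ℝ := fun s => (ρ k).normed volume (z - s)
    have hψs : ContDiff ℝ ∞ ψ := hsm.comp (contDiff_const.sub contDiff_id)
    have hψsupp : tsupport ψ ⊆ Metric.closedBall z (ρ k).rOut := by
      refine closure_minimal (fun s hs => ?_) Metric.isClosed_closedBall
      have : z - s ∈ Function.support ((ρ k).normed (volume : Measure (Vec N))) := hs
      rw [ContDiffBump.support_normed_eq, mem_ball_zero_iff, ← dist_eq_norm] at this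
      rw [Metric.mem_closedBall, dist_comm]
      exact this.le
    have hsub : Metric.closedBall z (ρ k).rOut ⊆ Metric.ball x (2 * r) := by
      refine Metric.closedBall_subset_ball' ?_
      have := Metric.mem_ball.1 hz
      linarith [hρle k]
    have hψ : IsTestFunction Ω ψ :=
      ⟨hψs, HasCompactSupport.of_support_subset_isCompact (isCompact_closedBall z (ρ k).rOut)
        (subset_closure.trans hψsupp), hψsupp.trans (hsub.trans hball)⟩
    have hpd : ∀ s, pderiv i ψ s =
        -(fderiv ℝ ((ρ k).normed volume) (z - s) (EuclideanSpace.single i 1)) := by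
      intro s
      have h1 : HasFDerivAt (fun s : Vec N => z - s) (-(ContinuousLinearMap.id ℝ (Vec N))) s := by
        simpa using (hasFDerivAt_id s).const_sub z
      have h2 := ((hsm.differentiable (by simp) (z - s)).hasFDerivAt).comp s h1
      have h3 : fderiv ℝ ψ s = _ := h2.fderiv
      rw [pderiv, h3]
      simp
    calc _ = ∫ t, fderiv ℝ ((ρ k).normed volume) t (EuclideanSpace.single i 1) * w (z - t) := by
            rfl
      _ = ∫ s, fderiv ℝ ((ρ k).normed volume) (z - s) (EuclideanSpace.single i 1) * w s := by
            rw [← integral_sub_left_eq_self _ volume z]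
            simp
      _ = -∫ s, w s * pderiv i ψ s := by
            rw [← integral_neg]
            congr 1
            ext s
            rw [hpd]
            ring
      _ = -∫ s in Ω, u s * pderiv i ψ s := by
            congr 1
            rw [← setIntegral_eq_integral_of_forall_compl_eq_zero (s := Ω)]
            · refine integral_congr_ae (ae_of_all _ fun s => ?_)
              by_cases hs : s ∈ Metric.ball x (2 * r)
              · simp [hw, hs]
              · simp [pderiv_eq_zero_of_notMem (fun h => hs (hsub (hψsupp h))) i]
            · intro s hs
              rw [pderiv_eq_zero_of_notMem (fun h => hs (hψ.2.2 h)) i, mul_zero]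
      _ = 0 := by rw [hweak i ψ hψ, neg_zero]
  have hconst : ∀ k, ∀ y ∈ Metric.ball x r, ∀ z ∈ Metric.ball x r,
      ((ρ k).normed volume ⋆[ContinuousLinearMap.lsmul ℝ ℝ, volume] w) y =
      ((ρ k).normed volume ⋆[ContinuousLinearMap.lsmul ℝ ℝ, volume] w) z := by
    intro k y hy z hz
    exact (Metric.isOpen_ball).is_const_of_fderiv_eq_zero (𝕜 := ℝ)
      (convex_ball x r).isPreconnected
      (fun t ht => (hderiv k t ht).differentiableAt.differentiableWithinAt)
      (fun t ht => (hderiv k t ht).fderiv) hy hz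
  have hlim' := (ae_restrict_of_ae (s := Metric.ball x r) hlim).and
    (ae_restrict_mem measurableSet_ball)
  have hne : NeBot (ae (volume.restrict (Metric.ball x r))) := by
    rw [ae_neBot, Ne, Measure.restrict_eq_zero]
    exact (Metric.measure_ball_pos volume x hr).ne'
  obtain ⟨y, hy, hyb⟩ := hlim'.exists
  refine ⟨w y, ?_⟩
  filter_upwards [hlim'] with z hz
  have hz2 : z ∈ Metric.ball x (2 * r) := Metric.ball_subset_ball (by linarith) hz.2
  have : w z = u z := indicator_of_mem hz2 u
  rw [← this]
  exact tendsto_nhds_unique (hz.1.congr fun k => hconst k z hz.2 y hyb) hy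

/-- A square-integrable function all of whose weak partial derivatives vanish on a connected open
set is almost everywhere constant. -/
theorem ae_eq_const_of_weak_grad_eq_zero {u : Vec N → ℝ} (hΩ : IsOpen Ω) (hc : IsConnected Ω)
    (hu : MemLp u 2 (volume.restrict Ω))
    (hweak : ∀ i, ∀ φ, IsTestFunction Ω φ → ∫ y in Ω, u y * pderiv i φ y = 0) :
    ∃ c, ∀ᵐ y ∂volume.restrict Ω, u y = c := by
  -- The sets `S c` are open, pairwise disjoint and cover `Ω`; by connectedness a single one
  -- contains `Ω`.
  let S : ℝ → Set (Vec N) := fun c =>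
    {x | ∃ r > 0, Metric.ball x r ⊆ Ω ∧ ∀ᵐ y ∂volume.restrict (Metric.ball x r), u y = c}
  have hSopen : ∀ c, IsOpen (S c) := by
    intro c
    rw [Metric.isOpen_iff]
    rintro x ⟨r, hr, hsub, hae⟩
    refine ⟨r / 2, half_pos hr, fun y hy => ⟨r / 2, half_pos hr, ?_⟩⟩
    have : Metric.ball y (r / 2) ⊆ Metric.ball x r :=
      Metric.ball_subset_ball' (by linarith [Metric.mem_ball.1 hy])
    exact ⟨this.trans hsub, ae_restrict_of_ae_restrict_of_subset this hae⟩
  have hcover : ∀ x ∈ Ω, ∃ c, x ∈ S c := by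
    intro x hx
    obtain ⟨r, hr, hsub⟩ := Metric.isOpen_iff.1 hΩ x hx
    have hsub' : Metric.ball x (2 * (r / 2)) ⊆ Ω := by rwa [mul_div_cancel₀ r two_ne_zero]
    have hint : IntegrableOn u (Metric.ball x (2 * (r / 2))) := by
      have : IsFiniteMeasure (volume.restrict (Metric.ball x (2 * (r / 2)))) :=
        ⟨by simpa using measure_ball_lt_top⟩
      exact (hu.mono_measure (Measure.restrict_mono hsub' le_rfl)).integrable (by norm_num)
    obtain ⟨c, hc⟩ := ae_eq_const_on_ball (half_pos hr) hsub' hint hweak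
    exact ⟨c, r / 2, half_pos hr, (Metric.ball_subset_ball (by linarith)).trans hsub, hc⟩
  have huniq : ∀ c d x, x ∈ S c → x ∈ S d → c = d := by
    rintro c d x ⟨r, hr, -, h1⟩ ⟨t, ht, -, h2⟩
    have hm : 0 < min r t := lt_min hr ht
    have hne : NeBot (ae (volume.restrict (Metric.ball x (min r t)))) := by
      rw [ae_neBot, Ne, Measure.restrict_eq_zero]
      exact (Metric.measure_ball_pos volume x hm).ne'
    have h1' := ae_restrict_of_ae_restrict_of_subset
      (Metric.ball_subset_ball (x := x) (min_le_left r t)) h1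
    have h2' := ae_restrict_of_ae_restrict_of_subset
      (Metric.ball_subset_ball (x := x) (min_le_right r t)) h2
    obtain ⟨y, hy1, hy2⟩ := (h1'.and h2').exists
    exact hy1.symm.trans hy2
  obtain ⟨x₀, hx₀⟩ := hc.nonempty
  obtain ⟨c, hcx⟩ := hcover x₀ hx₀
  have hsub : Ω ⊆ S c := by
    refine hc.isPreconnected.subset_left_of_subset_union (hSopen c)
      (isOpen_biUnion fun d (_ : d ≠ c) => hSopen d) ?_ ?_ ⟨x₀, hx₀, hcx⟩
    · rw [Set.disjoint_left]
      intro x hx hx'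
      obtain ⟨d, hd, hxd⟩ := mem_iUnion₂.1 hx'
      exact hd (huniq d c x hxd hx)
    · intro x hx
      obtain ⟨d, hd⟩ := hcover x hx
      by_cases h : d = c
      · exact Or.inl (h ▸ hd)
      · exact Or.inr (mem_iUnion₂.2 ⟨d, h, hd⟩)
  refine ⟨c, ?_⟩
  rw [ae_restrict_iff' hΩ.measurableSet, ae_iff]
  refine measure_null_of_locally_null _ fun x hx => ?_
  have hxΩ : x ∈ Ω := by
    by_contra h
    exact hx fun h' => absurd h' h
  obtain ⟨r, hr, -, hae⟩ := hsub hxΩ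
  refine ⟨_, inter_mem_nhdsWithin _ (Metric.ball_mem_nhds x hr), ?_⟩
  rw [ae_restrict_iff' measurableSet_ball, ae_iff] at hae
  refine measure_mono_null (fun y hy => ?_) hae
  intro h
  exact hy.1 fun _ => h hy.2

end WeaklyConstant

/-! ### Poincaré's inequality and compactness of Jacobians from the Korn property. -/

section Sobolev

variable {u u' : Vec N → ℝ} {g g' : Vec N → Fin N → ℝ}

theorem IsH1.sub (h : IsH1 Ω u g) (h' : IsH1 Ω u' g') :
    IsH1 Ω (fun x => u x - u' x) (fun x => g x - g' x) where
  memL2 := h.memL2.sub h'.memL2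
  grad_memL2 := h.grad_memL2.sub h'.grad_memL2
  weak_grad i φ hφ := by
    have e1 := integral_sub ((h.memL2 ()).integrable_mul (hφ.memLp_pderiv i _))
      ((h'.memL2 ()).integrable_mul (hφ.memLp_pderiv i _))
    have e2 := integral_sub ((h.grad_memL2 i).integrable_mul (hφ.memLp _))
      ((h'.grad_memL2 i).integrable_mul (hφ.memLp _))
    simp only [Pi.mul_apply, scalar] at e1 e2
    simp only [Pi.sub_apply, sub_mul]
    rw [e1, e2, h.weak_grad i φ hφ, h'.weak_grad i φ hφ]
    ring

theorem IsH1.const_smul (h : IsH1 Ω u g) (c : ℝ) :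
    IsH1 Ω (fun x => c * u x) (fun x => c • g x) where
  memL2 := h.memL2.const_smul c
  grad_memL2 := h.grad_memL2.const_smul c
  weak_grad i φ hφ := by
    simp only [Pi.smul_apply, smul_eq_mul, mul_assoc]
    rw [integral_const_mul, integral_const_mul, h.weak_grad i φ hφ]
    ring

theorem IsH1.mono {P : Set (Vec N)} (hP : P ⊆ Ω) (hΩm : MeasurableSet Ω)
    (h : IsH1 Ω u g) : IsH1 P u g where
  memL2 := h.memL2.mono hP
  grad_memL2 := h.grad_memL2.mono hP
  weak_grad i φ hφ := by
    have h0 : ∀ x ∉ P, x ∉ tsupport φ := fun x hx hx' => hx (hφ.2.2 hx')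
    have e1 := setIntegral_eq_of_subset_of_forall_sdiff_eq_zero (μ := volume) hΩm hP
      (f := fun x => u x * pderiv i φ x)
      (fun x hx => by simp [pderiv_eq_zero_of_notMem (h0 x hx.2)])
    have e2 := setIntegral_eq_of_subset_of_forall_sdiff_eq_zero (μ := volume) hΩm hP
      (f := fun x => g x i * φ x)
      (fun x hx => by simp [image_eq_zero_of_notMem_tsupport (h0 x hx.2)])
    rw [← e1, ← e2]
    exact h.weak_grad i φ (hφ.mono hP)

/-- This is integration by parts against 1: constants have weak gradient zero, so they may be
subtracted freely. -/
theorem IsTestFunction.integral_pderiv {φ : Vec N → ℝ} (hφ : IsTestFunction Ω φ) (i : Fin N) :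
    ∫ x in Ω, pderiv i φ x = 0 := by
  rw [setIntegral_eq_integral_of_forall_compl_eq_zero
    (fun x hx => pderiv_eq_zero_of_notMem (fun h => hx (hφ.2.2 h)) i)]
  have hint := (continuous_pderiv hφ.1 i).integrable_of_hasCompactSupport (μ := volume)
    (hasCompactSupport_pderiv hφ.2.1 i)
  have hint' := hφ.1.continuous.integrable_of_hasCompactSupport (μ := volume) hφ.2.1
  have := integral_mul_fderiv_eq_neg_fderiv_mul_of_integrable (μ := (volume : Measure (Vec N)))
    (f := fun _ => (1 : ℝ)) (g := φ) (v := EuclideanSpace.single i 1) (by simp)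
    (by simp only [one_mul]; exact hint) (by simpa using hint')
    (fun x _ => by fun_prop) (fun x _ => (hφ.1.differentiable (by simp)) x)
  simpa [pderiv] using this

theorem IsH1.sub_const (hfin : volume Ω ≠ ⊤) (h : IsH1 Ω u g) (m : ℝ) :
    IsH1 Ω (fun x => u x - m) g := by
  have : IsFiniteMeasure (volume.restrict Ω) := ⟨by simpa using hfin.lt_top⟩
  have hm : IsH1 Ω (fun _ => m) (0 : Vec N → Fin N → ℝ) := by
    refine ⟨fun _ => memLp_const m, fun _ => memLp_const 0, fun i φ hφ => ?_⟩
    rw [integral_const_mul, hφ.integral_pderiv i]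
    simp
  simpa using h.sub hm

/-- A failing sequence, centred at its means and normalised, has gradients tending to zero. By
Rellich it has an L² limit point, which has zero weak gradient and zero mean, hence vanishes,
although the norms are all one. -/
theorem exists_poincare (hΩ : IsOpen Ω) (hc : IsConnected Ω) (hfin : volume Ω ≠ ⊤)
    (hK : KornProperty Ω) :
    ∃ C, 0 ≤ C ∧ ∀ u g, IsH1 Ω u g → ∃ m : ℝ,
      l2Norm Ω (scalar fun x => u x - m) ≤ C * l2Norm Ω g := by
  have hfm : IsFiniteMeasure (volume.restrict Ω) := ⟨by simpa using hfin.lt_top⟩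
  by_contra! hcon
  choose u g hH hlt using fun k : ℕ => hcon (k + 1 : ℝ) (by positivity)
  -- The negated claim holds for every constant, in particular for the mean value.
  let m : ℕ → ℝ := fun k => ⨍ x in Ω, u k x
  let a : ℕ → ℝ := fun k => l2Norm Ω (scalar fun x => u k x - m k)
  have ha : ∀ k, 0 < a k := fun k =>
    lt_of_le_of_lt (mul_nonneg (by positivity) (l2Norm_nonneg _)) (hlt k (m k))
  let w : ℕ → Vec N → ℝ := fun k x => (a k)⁻¹ * (u k x - m k)
  let h : ℕ → Vec N → Fin N → ℝ := fun k x => (a k)⁻¹ • g k x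
  have hw : ∀ k, IsH1 Ω (w k) (h k) := fun k => ((hH k).sub_const hfin (m k)).const_smul _
  have hw1 : ∀ k, l2Norm Ω (scalar (w k)) = 1 := fun k => by
    have e := l2Norm_const_smul (Ω := Ω) (a k)⁻¹ (scalar fun x => u k x - m k)
    rw [abs_of_pos (inv_pos.2 (ha k))] at e
    exact e.trans (inv_mul_cancel₀ (ha k).ne')
  have hh : ∀ k, l2Norm Ω (h k) ≤ 1 / ((k : ℝ) + 1) := fun k => by
    rw [l2Norm_const_smul, abs_of_pos (inv_pos.2 (ha k)), le_div_iff₀ (by positivity),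
      mul_assoc, inv_mul_le_iff₀ (ha k), mul_one, mul_comm]
    exact (hlt k (m k)).le
  have hh1 : ∀ k, l2Norm Ω (h k) ≤ 1 := fun k => (hh k).trans (by
    rw [div_le_one (by positivity)]
    linarith [(Nat.cast_nonneg k : (0 : ℝ) ≤ k)])
  obtain ⟨w', s, hw', hs, hlim⟩ := hK.rellich w h 1 fun k => ⟨hw k, (hw1 k).le, hh1 k⟩
  have hh0 : Tendsto (fun k => l2Norm Ω (h (s k))) atTop (𝓝 0) :=
    (squeeze_zero (fun k => l2Norm_nonneg _) hh tendsto_one_div_add_atTop_nhds_zero_nat).comp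
      hs.tendsto_atTop
  obtain ⟨c, hcst⟩ := ae_eq_const_of_weak_grad_eq_zero hΩ hc (hw' ()) fun i φ hφ => by
    have l1 := tendsto_integral_mul (fun k => (hw (s k)).memL2 ()) (hw' ())
      (hφ.memLp_pderiv i _) hlim
    have l2 := tendsto_integral_mul (f := fun k x => h (s k) x i) (g := fun _ => 0)
      (fun k => (hw (s k)).grad_memL2 i) (memLp_const 0) (hφ.memLp _)
      (squeeze_zero (fun k => l2Norm_nonneg _)
        (fun k => by simpa using l2Norm_scalar_le (hw (s k)).grad_memL2 i) hh0)
    refine tendsto_nhds_unique l1 ?_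
    simp only [zero_mul, integral_zero] at l2
    refine (neg_zero (G := ℝ) ▸ l2.neg).congr fun k => ?_
    exact ((hw (s k)).weak_grad i φ hφ).symm
  have hmean : ∫ x in Ω, w' x = 0 := by
    have l1 := tendsto_integral_mul (h := fun _ => (1 : ℝ)) (fun k => (hw (s k)).memL2 ())
      (hw' ()) (memLp_const 1) hlim
    simp only [mul_one] at l1
    refine tendsto_nhds_unique l1 (tendsto_const_nhds.congr fun k => ?_)
    show 0 = ∫ x in Ω, (a (s k))⁻¹ * (u (s k) x - m (s k))
    rw [integral_const_mul, integral_sub_average, mul_zero]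
  have hc0 : c = 0 := by
    have e : ∫ x in Ω, w' x = ∫ x in Ω, c := integral_congr_ae hcst
    rw [hmean, setIntegral_const, smul_eq_mul, eq_comm, mul_eq_zero] at e
    refine e.resolve_left ?_
    exact ENNReal.toReal_ne_zero.2 ⟨(hΩ.measure_pos volume hc.nonempty).ne', hfin⟩
  have hw0 : l2Norm Ω (scalar w') = 0 := by
    rw [l2Norm_eq_zero_iff hw']
    filter_upwards [hcst] with x hx
    ext
    exact hx.trans hc0
  have : (1 : ℝ) ≤ 0 := by
    refine ge_of_tendsto hlim (Eventually.of_forall fun k => ?_)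
    have := abs_l2Norm_sub_le (hw (s k)).memL2 hw'
    rwa [hw1, hw0, sub_zero, abs_one] at this
  linarith

variable {v v' : Vec N → Fin N → ℝ} {G H : Vec N → Ten N}

theorem IsH1Vec.memL2 (h : IsH1Vec Ω v G) : MemL2 Ω v := fun n => (h n).memL2 ()

theorem IsH1Vec.entries_memL2 (h : IsH1Vec Ω v G) : MemL2 Ω (entries G) :=
  fun p => (h p.1).grad_memL2 p.2

theorem IsH1Vec.sub (h : IsH1Vec Ω v G) (h' : IsH1Vec Ω v' H) :
    IsH1Vec Ω (fun x => v x - v' x) (fun x => G x - H x) := fun n => (h n).sub (h' n)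

theorem IsH1Vec.const_smul (h : IsH1Vec Ω v G) (c : ℝ) :
    IsH1Vec Ω (fun x => c • v x) (fun x => c • G x) := fun n => (h n).const_smul c

theorem entries_symPart_memL2 (h : MemL2 Ω (entries G)) : MemL2 Ω (entries (symPart G)) :=
  fun p => by
    have := ((h p).add (h p.swap)).const_mul (1 / 2 : ℝ)
    exact this

theorem entries_symPart_sub (G H : Vec N → Ten N) :
    entries (symPart fun x => G x - H x) =
      fun x => entries (symPart G) x - entries (symPart H) x := by
  ext x p
  simp [entries, symPart]
  ring

theorem entries_symPart_const_smul (c : ℝ) (G : Vec N → Ten N) :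
    entries (symPart fun x => c • G x) = fun x => c • entries (symPart G) x := by
  ext x p
  simp [entries, symPart]
  ring

theorem l2Norm_row_le (h : MemL2 Ω (entries G)) (n : Fin N) :
    l2Norm Ω (row G n) ≤ l2Norm Ω (entries G) :=
  l2Norm_le_of_forall h fun x => by
    rw [Fintype.sum_prod_type]
    exact Finset.single_le_sum (f := fun n => ∑ j, entries G x (n, j) ^ 2)
      (fun i _ => by positivity) (Finset.mem_univ n)

theorem l2Norm_symPart_le (h : MemL2 Ω (entries G)) :
    l2Norm Ω (entries (symPart G)) ≤ l2Norm Ω (entries G) :=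
  l2Norm_le_of_forall h fun x => by
    have h1 : ∑ p : Fin N × Fin N, entries G x p.swap ^ 2 = ∑ p, entries G x p ^ 2 :=
      Equiv.sum_comp (Equiv.prodComm (Fin N) (Fin N)) fun p => entries G x p ^ 2
    have h2 : ∑ p : Fin N × Fin N, (entries G x p ^ 2 + entries G x p.swap ^ 2) / 2 =
        ∑ p, entries G x p ^ 2 := by
      rw [← Finset.sum_div, Finset.sum_add_distrib, h1]
      ring
    rw [← h2]
    refine Finset.sum_le_sum fun p _ => ?_
    simp only [entries, symPart, Matrix.smul_apply, Matrix.add_apply, Matrix.transpose_apply,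
      smul_eq_mul, Prod.fst_swap, Prod.snd_swap]
    nlinarith [sq_nonneg (G x p.1 p.2 - G x p.2 p.1)]

/-- As a limit over pairs of indices, the Cauchy property can be handled by squeezing and by the
arithmetic of limits. -/
theorem cauchyL2_iff_tendsto {ι : Type} [Fintype ι] {f : ℕ → Vec N → ι → ℝ} :
    CauchyL2 Ω f ↔
      Tendsto (fun p : ℕ × ℕ => l2Norm Ω (fun x => f p.1 x - f p.2 x)) atTop (𝓝 0) := by
  rw [Metric.tendsto_atTop]
  simp only [Real.dist_eq, sub_zero, abs_of_nonneg (l2Norm_nonneg _)]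
  refine forall₂_congr fun ε hε => ⟨?_, ?_⟩
  · rintro ⟨K, hK⟩
    exact ⟨(K, K), fun p hp => hK _ hp.1 _ hp.2⟩
  · rintro ⟨⟨K, L⟩, h⟩
    exact ⟨max K L, fun k hk l hl =>
      h (k, l) ⟨(le_max_left _ _).trans hk, (le_max_right _ _).trans hl⟩⟩

/-- A sequence of displacement fields with bounded gradients and strains tending to zero has a
subsequence with convergent gradients. -/
theorem exists_cauchyL2_subsequence (hΩ : IsOpen Ω) (hc : IsConnected Ω) (hfin : volume Ω ≠ ⊤)
    (hK : KornProperty Ω) {v : ℕ → Vec N → Fin N → ℝ} {G : ℕ → Vec N → Ten N}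
    (hv : ∀ k, IsH1Vec Ω (v k) (G k)) {M : ℝ} (hM : ∀ k, l2Norm Ω (entries (G k)) ≤ M)
    (hsym : Tendsto (fun k => l2Norm Ω (entries (symPart (G k)))) atTop (𝓝 0)) :
    ∃ s : ℕ → ℕ, StrictMono s ∧ CauchyL2 Ω (fun k => entries (G (s k))) := by
  obtain ⟨C, hC, hpoin⟩ := exists_poincare hΩ hc hfin hK
  choose m hm using fun k n => hpoin _ _ (hv k n)
  -- Shifting by constants leaves the Jacobians unchanged and, by Poincaré, bounds the components in
  -- L², as Rellich demands.
  let v' : ℕ → Vec N → Fin N → ℝ := fun k x n => v k x n - m k n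
  have hv' : ∀ k, IsH1Vec Ω (v' k) (G k) := fun k n => (hv k n).sub_const hfin (m k n)
  have hrow : ∀ k n, l2Norm Ω (row (G k) n) ≤ M := fun k n =>
    (l2Norm_row_le (hv k).entries_memL2 n).trans (hM k)
  obtain ⟨s, hs, hcau⟩ := exists_common_subsequence
    (fun (n : Fin N) (s : ℕ → ℕ) => CauchyL2 Ω fun k => scalar fun x => v' (s k) x n)
    (fun n s t ht h => h.comp_strictMono ht)
    (fun n s _ => by
      obtain ⟨w, t, hw, ht, hlim⟩ := hK.rellich (fun k x => v' (s k) x n)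
        (fun k => row (G (s k)) n) (max M (C * M)) fun k => ⟨hv' (s k) n,
          ((hm _ _).trans (mul_le_mul_of_nonneg_left (hrow _ _) hC)).trans (le_max_right _ _),
          (hrow _ _).trans (le_max_left _ _)⟩
      exact ⟨t, ht, cauchyL2_of_tendsto (fun k => (hv' (s (t k)) n).memL2) hw hlim⟩)
  refine ⟨s, hs, cauchyL2_iff_tendsto.2 ?_⟩
  obtain ⟨c, hc0, hkorn⟩ := hK.second_korn
  have hsym' := hsym.comp hs.tendsto_atTop
  have hlim : Tendsto (fun p : ℕ × ℕ => c⁻¹ * (∑ n, l2Norm Ω (fun x =>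
      scalar (fun x => v' (s p.1) x n) x - scalar (fun x => v' (s p.2) x n) x) +
      (l2Norm Ω (entries (symPart (G (s p.1)))) + l2Norm Ω (entries (symPart (G (s p.2)))))))
      atTop (𝓝 0) := by
    have h1 := tendsto_finsetSum (Finset.univ : Finset (Fin N))
      fun n _ => cauchyL2_iff_tendsto.1 (hcau n)
    have h2 : Tendsto (fun p : ℕ × ℕ => l2Norm Ω (entries (symPart (G (s p.1))))) atTop (𝓝 0) := by
      rw [← prod_atTop_atTop_eq]
      exact hsym'.comp tendsto_fst
    have h3 : Tendsto (fun p : ℕ × ℕ => l2Norm Ω (entries (symPart (G (s p.2))))) atTop (𝓝 0) := by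
      rw [← prod_atTop_atTop_eq]
      exact hsym'.comp tendsto_snd
    simpa using (h1.add (h2.add h3)).const_mul c⁻¹
  refine squeeze_zero (fun _ => l2Norm_nonneg _) (fun p => ?_) hlim
  rw [← div_eq_inv_mul, le_div_iff₀ hc0, mul_comm]
  -- Korn's second inequality for a difference: its L² part is small because the components are
  -- Cauchy, its strain part because each strain tends to zero.
  have hsub := (hv' (s p.1)).sub (hv' (s p.2))
  refine (hkorn _ _ hsub).trans (add_le_add ?_ ?_)
  · exact l2Norm_le_sum hsub.memL2
  · rw [entries_symPart_sub]
    exact l2Norm_sub_le_add (entries_symPart_memL2 (hv' _).entries_memL2)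
      (entries_symPart_memL2 (hv' _).entries_memL2)

/-- Squared norms add up over disjoint pieces filling `Ω` up to a null set, and a sum of squares is
at most the square of the sum. -/
theorem l2Norm_le_sum_pieces {ι κ : Type} [Fintype ι] [Fintype κ] {P : κ → Set (Vec N)}
    (hP : ∀ j, P j ⊆ Ω) (hopen : ∀ j, IsOpen (P j)) (hnull : volume (Ω \ ⋃ j, P j) = 0)
    (hdisj : Pairwise fun i j => Disjoint (P i) (P j)) {f : Vec N → ι → ℝ} (hf : MemL2 Ω f) :
    l2Norm Ω f ≤ ∑ j, l2Norm (P j) f := by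
  refine abs_le_of_sq_le_sq' ?_ (Finset.sum_nonneg fun k _ => l2Norm_nonneg _) |>.2
  have hae : Ω =ᵐ[volume] ⋃ j, P j :=
    (ae_le_set.2 hnull).antisymm (iUnion_subset hP).eventuallyLE
  rw [l2Norm_sq, setIntegral_congr_set hae, integral_iUnion_fintype
    (fun j => (hopen j).measurableSet) hdisj fun j => hf.integrable_sq.mono_set (hP j)]
  refine le_trans (le_of_eq ?_) (Finset.sum_sq_le_sq_sum_of_nonneg fun k _ => l2Norm_nonneg _)
  exact Finset.sum_congr rfl fun j _ => (l2Norm_sq f).symm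

theorem cauchyL2_of_pieces {ι κ : Type} [Fintype ι] [Fintype κ] {P : κ → Set (Vec N)}
    (hP : ∀ j, P j ⊆ Ω) (hopen : ∀ j, IsOpen (P j)) (hnull : volume (Ω \ ⋃ j, P j) = 0)
    (hdisj : Pairwise fun i j => Disjoint (P i) (P j)) {f : ℕ → Vec N → ι → ℝ}
    (hf : ∀ k, MemL2 Ω (f k)) (h : ∀ j, CauchyL2 (P j) f) : CauchyL2 Ω f := by
  simp only [cauchyL2_iff_tendsto] at h ⊢
  refine squeeze_zero (fun _ => l2Norm_nonneg _)
    (fun p => l2Norm_le_sum_pieces hP hopen hnull hdisj ((hf p.1).sub (hf p.2))) ?_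
  simpa using tendsto_finsetSum (Finset.univ : Finset κ) fun j _ => h j

end Sobolev

/-! ### The weak tangential condition and rigidity of skew fields. -/

section Boundary

variable {Γt : Set (Vec N)}

variable {Ψ : Vec N → Fin N → ℝ} {E : Vec N → Fin N → ℝ}

theorem IsBdryTestField.contDiff_apply (hΨ : IsBdryTestField Ω Γt Ψ) (j : Fin N) :
    ContDiff ℝ ∞ (fun x => Ψ x j) :=
  contDiff_pi.1 hΨ.smooth j

theorem IsBdryTestField.hasCompactSupport_apply (hΨ : IsBdryTestField Ω Γt Ψ) (j : Fin N) :
    HasCompactSupport (fun x => Ψ x j) :=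
  hΨ.compact.comp_left (g := fun y : Fin N → ℝ => y j) rfl

/-- The extension by zero of a test field is smooth across `Γt`, so that one may integrate by parts
on `Ω` against test functions that do not vanish on `Γt`. -/
theorem IsBdryTestField.integral_mul_pderiv (hΩ : IsOpen Ω) (hΨ : IsBdryTestField Ω Γt Ψ)
    {U : Set (Vec N)} (hU : U ∩ frontier Ω ⊆ Γt) {φ : Vec N → ℝ} (hφ : IsTestFunction U φ)
    (i j : Fin N) :
    ∫ x in Ω, Ψ x j * pderiv i φ x = -∫ x in Ω, pderiv i (fun y => Ψ y j) x * φ x := by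
  set ψ : Vec N → ℝ := fun x => Ψ x j with hψ
  have hψs : ContDiff ℝ ∞ ψ := hΨ.contDiff_apply j
  have hin : ∀ x ∈ Ω, Ω.indicator ψ =ᶠ[𝓝 x] ψ := fun x hx => by
    filter_upwards [hΩ.mem_nhds hx] with y hy using indicator_of_mem hy ψ
  -- A point of the support outside `Ω` is either exterior, or lies in U ∩ ∂Ω and hence on `Γt`,
  -- near which Ψ vanishes inside `Ω`.
  have hout : ∀ x ∈ tsupport φ, x ∉ Ω → Ω.indicator ψ =ᶠ[𝓝 x] fun _ => 0 := by
    intro x hx hxΩ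
    by_cases hcl : x ∈ closure Ω
    · have hxΓ : x ∈ Γt := hU ⟨hφ.2.2 hx, hΩ.frontier_eq ▸ ⟨hcl, hxΩ⟩⟩
      obtain ⟨δ, hδ, haway⟩ := hΨ.away
      filter_upwards [Metric.ball_mem_nhds x hδ] with y hy
      by_cases hyΩ : y ∈ Ω
      · rw [indicator_of_mem hyΩ, hψ]
        by_contra h
        exact absurd (haway y hyΩ (fun h0 => h (congrFun h0 j)) x hxΓ)
          (not_le.2 (Metric.mem_ball.1 hy))
      · exact indicator_of_notMem hyΩ ψ
    · filter_upwards [isClosed_closure.isOpen_compl.mem_nhds hcl] with y hy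
      exact indicator_of_notMem (fun h => hy (subset_closure h)) ψ
  have hmul : (fun x => Ω.indicator ψ x * pderiv i φ x) =
      Ω.indicator fun x => ψ x * pderiv i φ x := by
    ext x
    by_cases hx : x ∈ Ω <;> simp [hx]
  have hmul' : (fun x => fderiv ℝ (Ω.indicator ψ) x (EuclideanSpace.single i 1) * φ x) =
      Ω.indicator fun x => pderiv i ψ x * φ x := by
    ext x
    by_cases hx : x ∈ Ω
    · simp [hx, (hin x hx).fderiv_eq, pderiv]
    · by_cases hxs : x ∈ tsupport φ
      · simp [hx, (hout x hxs hx).fderiv_eq]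
      · simp [hx, image_eq_zero_of_notMem_tsupport hxs]
  have hint {f : Vec N → ℝ} (hf : Continuous f) (hc : HasCompactSupport f) :
      Integrable (Ω.indicator f) :=
    (hf.integrable_of_hasCompactSupport hc).indicator hΩ.measurableSet
  have key := integral_mul_fderiv_eq_neg_fderiv_mul_of_integrable
    (μ := (volume : Measure (Vec N))) (f := Ω.indicator ψ) (g := φ)
    (v := EuclideanSpace.single i 1)
    (by
      rw [hmul']
      exact hint ((continuous_pderiv hψs i).mul hφ.1.continuous) hφ.2.1.mul_left)
    (by
      refine hmul ▸ hint (hψs.continuous.mul (continuous_pderiv hφ.1 i)) ?_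
      exact (hasCompactSupport_pderiv hφ.2.1 i).mul_left)
    (by
      have : (fun x => Ω.indicator ψ x * φ x) = Ω.indicator fun x => ψ x * φ x := by
        ext x
        by_cases hx : x ∈ Ω <;> simp [hx]
      rw [this]
      exact hint (hψs.continuous.mul hφ.1.continuous) hφ.2.1.mul_left)
    (fun x hx => by
      by_cases hxΩ : x ∈ Ω
      · exact (hψs.differentiable (by simp) x).congr_of_eventuallyEq (hin x hxΩ)
      · exact (differentiableAt_const 0).congr_of_eventuallyEq (hout x hx hxΩ))
    (fun x _ => hφ.1.differentiable (by simp) x)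
  rw [hmul', integral_indicator hΩ.measurableSet] at key
  rw [← key, ← integral_indicator hΩ.measurableSet, ← hmul]
  rfl

/-- Weak form of the conditions `curl E = 0` in `Ω` and `E × ν = 0` on `Γt`: the extension of `E`
by zero is irrotational in all open sets that meet the boundary of `Ω` only in `Γt`. -/
def IsCurlFreeAcross (Ω Γt : Set (Vec N)) (E : Vec N → Fin N → ℝ) : Prop :=
  ∀ U, IsOpen U → U ∩ frontier Ω ⊆ Γt → ∀ φ, IsTestFunction U φ → ∀ i j,
    ∫ x in Ω, E x j * pderiv i φ x = ∫ x in Ω, E x i * pderiv j φ x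

/-- For the approximating test fields, integration by parts has no boundary term, and the remaining
rotation tends to zero in L². -/
theorem IsHcurlCirc.isCurlFreeAcross (hΩ : IsOpen Ω) (hE : IsHcurlCirc Ω Γt E 0) :
    IsCurlFreeAcross Ω Γt E := by
  intro U _ hsub φ hφ
  suffices h : ∀ p : RotIdx N,
      ∫ x in Ω, E x p.1.2 * pderiv p.1.1 φ x = ∫ x in Ω, E x p.1.1 * pderiv p.1.2 φ x by
    intro i j
    rcases lt_trichotomy i j with hij | rfl | hij
    · exact h ⟨(i, j), hij⟩
    · rfl
    · exact (h ⟨(j, i), hij⟩).symm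
  intro p
  choose Ψ hΨ hE' hC' using fun k : ℕ => hE.2 (1 / ((k : ℝ) + 1)) (by positivity)
  have hΨm : ∀ k, MemL2 Ω (Ψ k) := fun k j =>
    ((hΨ k).contDiff_apply j).continuous.memLp_of_hasCompactSupport
      ((hΨ k).hasCompactSupport_apply j)
  have hpd : ∀ k i j, MemLp (pderiv i fun y => Ψ k y j) 2 (volume.restrict Ω) := fun k i j =>
    (continuous_pderiv ((hΨ k).contDiff_apply j) i).memLp_of_hasCompactSupport
      (hasCompactSupport_pderiv ((hΨ k).hasCompactSupport_apply j) i)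
  have hCm : ∀ k, MemL2 Ω (curl (Ψ k)) := fun k p => (hpd k _ _).sub (hpd k _ _)
  have hlim (i j : Fin N) : Tendsto (fun k => ∫ x in Ω, Ψ k x j * pderiv i φ x) atTop
      (𝓝 (∫ x in Ω, E x j * pderiv i φ x)) := by
    refine tendsto_integral_mul (fun k => hΨm k j) (hE.1.memL2 j) (hφ.memLp_pderiv i _)
      (squeeze_zero (fun _ => l2Norm_nonneg _) (fun k => ?_)
        tendsto_one_div_add_atTop_nhds_zero_nat)
    refine (l2Norm_scalar_le ((hΨm k).sub hE.1.memL2) j).trans ?_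
    rw [l2Norm_sub_comm]
    exact (hE' k).le
  have hlim' : Tendsto (fun k => ∫ x in Ω, curl (Ψ k) x p * φ x) atTop (𝓝 0) := by
    have h0 : MemL2 Ω (0 : Vec N → RotIdx N → ℝ) := fun _ => MemLp.zero
    have := tendsto_integral_mul (fun k => hCm k p) (h0 p) (hφ.memLp (volume.restrict Ω))
      (squeeze_zero (fun _ => l2Norm_nonneg _) (fun k => by
          refine (l2Norm_scalar_le ((hCm k).sub h0) p).trans ?_
          rw [l2Norm_sub_comm]
          exact (hC' k).le)
        tendsto_one_div_add_atTop_nhds_zero_nat)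
    simpa using this
  have heq : ∀ k, ∫ x in Ω, Ψ k x p.1.2 * pderiv p.1.1 φ x =
      (∫ x in Ω, Ψ k x p.1.1 * pderiv p.1.2 φ x) - ∫ x in Ω, curl (Ψ k) x p * φ x := by
    intro k
    have e := integral_sub ((hpd k p.1.1 p.1.2).integrable_mul (hφ.memLp _))
      ((hpd k p.1.2 p.1.1).integrable_mul (hφ.memLp _))
    simp only [Pi.mul_apply] at e
    rw [(hΨ k).integral_mul_pderiv hΩ hsub hφ, (hΨ k).integral_mul_pderiv hΩ hsub hφ]
    simp only [curl, sub_mul]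
    rw [e]
    ring
  refine tendsto_nhds_unique (hlim p.1.1 p.1.2) ?_
  simpa using ((hlim p.1.2 p.1.1).sub hlim').congr fun k => (heq k).symm

theorem IsCurlFreeAcross.const_smul (hE : IsCurlFreeAcross Ω Γt E) (c : ℝ) :
    IsCurlFreeAcross Ω Γt (fun x => c • E x) := by
  intro U hU hsub φ hφ i j
  simp only [Pi.smul_apply, smul_eq_mul, mul_assoc]
  rw [integral_const_mul, integral_const_mul, hE U hU hsub φ hφ i j]

theorem isCurlFreeAcross_of_tendsto {Ek : ℕ → Vec N → Fin N → ℝ}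
    (hk : ∀ k, IsCurlFreeAcross Ω Γt (Ek k)) (hm : ∀ k, MemL2 Ω (Ek k)) (hE : MemL2 Ω E)
    (hlim : Tendsto (fun k => l2Norm Ω (fun x => Ek k x - E x)) atTop (𝓝 0)) :
    IsCurlFreeAcross Ω Γt E := by
  intro U hU hsub φ hφ i j
  have h (i j : Fin N) := tendsto_integral_mul (fun k => hm k j) (hE j)
    (hφ.memLp_pderiv i (volume.restrict Ω))
    (squeeze_zero (fun _ => l2Norm_nonneg _)
      (fun k => l2Norm_scalar_le ((hm k).sub hE) j) hlim)
  exact tendsto_nhds_unique (h i j) ((h j i).congr fun k => (hk k U hU hsub φ hφ i j).symm)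

/-- Near a boundary point with a Lipschitz chart there are exterior points. -/
theorem HasLipschitzChartAt.exists_open_subset_compl {x : Vec N} (h : HasLipschitzChartAt Ω x)
    (hx : x ∉ Ω) {V : Set (Vec N)} (hV : IsOpen V) (hxV : x ∈ V) :
    ∃ W, IsOpen W ∧ W.Nonempty ∧ W ⊆ V ∧ Disjoint W Ω := by
  obtain ⟨e, -, i, hxs, -, -, hiff⟩ := h
  have hxi : e x i ≤ 0 := not_lt.1 fun h => hx ((hiff x hxs).2 h)
  have hneg : IsOpen {y : Vec N | y i < 0} := isOpen_lt (by fun_prop) continuous_const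
  refine ⟨e.source ∩ e ⁻¹' {y | y i < 0} ∩ V, (e.isOpen_inter_preimage hneg).inter hV, ?_,
    inter_subset_right, ?_⟩
  -- Moving from e(x) a little in the direction of the negative i-th axis enters the open lower half
  -- space, even if e(x) lies on the hyperplane.
  · let y : ℝ → Vec N := fun t => e x - t • EuclideanSpace.single i 1
    have hy : Tendsto y (𝓝[>] 0) (𝓝 (e x)) := by
      have : Continuous y := by fun_prop
      simpa [y] using (this.tendsto 0).mono_left (nhdsWithin_le_nhds (s := Ioi 0))
    have hsymm : Tendsto (fun t => e.symm (y t)) (𝓝[>] 0) (𝓝 x) := by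
      have := (e.continuousAt_symm (e.map_source hxs)).tendsto.comp hy
      rwa [e.left_inv hxs] at this
    obtain ⟨t, ht, htV, ht0⟩ := ((hy.eventually (e.open_target.mem_nhds (e.map_source hxs))).and
      ((hsymm.eventually (hV.mem_nhds hxV)).and self_mem_nhdsWithin)).exists
    refine ⟨e.symm (y t), ⟨e.map_target ht, ?_⟩, htV⟩
    rw [mem_preimage, e.right_inv ht]
    have ht0' : 0 < t := ht0
    simp [y]
    linarith
  · rw [Set.disjoint_left]
    rintro z ⟨⟨hzs, hz⟩, -⟩ hzΩ
    exact lt_asymm ((hiff z hzs).1 hzΩ) hz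

/-- The indicator function of `Ω` has non-vanishing weak gradient near a boundary point with a
Lipschitz chart. -/
theorem exists_testFunction_integral_pderiv_ne_zero (hΩ : IsOpen Ω) {x : Vec N}
    (hx : x ∈ frontier Ω) (h : HasLipschitzChartAt Ω x) {U : Set (Vec N)} (hU : IsOpen U)
    (hxU : x ∈ U) : ∃ φ, IsTestFunction U φ ∧ ∃ i, ∫ y in Ω, pderiv i φ y ≠ 0 := by
  by_contra! hcon
  obtain ⟨r, hr, hsub⟩ := Metric.isOpen_iff.1 hU x hxU
  have hfm : IsFiniteMeasure (volume.restrict (Metric.ball x r)) :=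
    ⟨by simpa using measure_ball_lt_top⟩
  let χ : Vec N → ℝ := Ω.indicator fun _ => 1
  -- Otherwise the indicator of `Ω` would be almost everywhere constant on a ball, but it equals 0
  -- and 1 on non-empty open subsets of it.
  obtain ⟨c, hc⟩ := ae_eq_const_of_weak_grad_eq_zero (u := χ) Metric.isOpen_ball
    (Metric.isConnected_ball hr) ((memLp_const 1).indicator hΩ.measurableSet) fun i φ hφ => by
      rw [← hcon φ (hφ.mono hsub) i, setIntegral_eq_integral_of_forall_compl_eq_zero,
        ← integral_indicator hΩ.measurableSet]
      · congr 1
        ext y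
        by_cases hy : y ∈ Ω <;> simp [χ, hy]
      · intro y hy
        rw [pderiv_eq_zero_of_notMem (fun h => hy (hφ.2.2 h)), mul_zero]
  have hval : ∀ W, IsOpen W → W.Nonempty → W ⊆ Metric.ball x r → ∃ y ∈ W, χ y = c := by
    intro W hW hWne hWsub
    have hne : NeBot (ae (volume.restrict W)) := by
      rw [ae_neBot, Ne, Measure.restrict_eq_zero]
      exact (hW.measure_pos volume hWne).ne'
    obtain ⟨y, hy, hyW⟩ := ((ae_restrict_of_ae_restrict_of_subset hWsub hc).and
      (ae_restrict_mem hW.measurableSet)).exists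
    exact ⟨y, hyW, hy⟩
  have hxΩ : x ∉ Ω := (hΩ.frontier_eq ▸ hx).2
  obtain ⟨W, hW, hWne, hWsub, hWd⟩ := h.exists_open_subset_compl hxΩ Metric.isOpen_ball
    (Metric.mem_ball_self hr)
  obtain ⟨y, hy, hyc⟩ := hval W hW hWne hWsub
  obtain ⟨z, hz, hzc⟩ := hval (Metric.ball x r ∩ Ω) (Metric.isOpen_ball.inter hΩ)
    (mem_closure_iff.1 (frontier_subset_closure hx) _ Metric.isOpen_ball (Metric.mem_ball_self hr))
    inter_subset_left
  have h0 : χ y = 0 := indicator_of_notMem (Set.disjoint_left.1 hWd hy) _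
  have h1 : χ z = 1 := indicator_of_mem hz.2 _
  linarith

/-- A skew-symmetric field with irrotational rows that are normal on a part of the boundary with
a Lipschitz chart vanishes. -/
theorem l2Norm_entries_eq_zero (hΩ : IsOpen Ω) (hc : IsConnected Ω) (hΓt : IsRelOpenBdry Ω Γt)
    {x : Vec N} (hx : x ∈ Γt) (hchart : HasLipschitzChartAt Ω x) {F : Vec N → Ten N}
    (hF : MemL2 Ω (entries F)) (hcurl : ∀ n, IsCurlFreeAcross Ω Γt (row F n))
    (hsym : l2Norm Ω (entries (symPart F)) = 0) : l2Norm Ω (entries F) = 0 := by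
  have hskew : ∀ᵐ y ∂volume.restrict Ω, ∀ n j, F y n j = -F y j n := by
    filter_upwards [(l2Norm_eq_zero_iff (entries_symPart_memL2 hF)).1 hsym] with y hy n j
    have := congrFun hy (n, j)
    simp [entries, symPart] at this
    linarith
  have hanti : ∀ (h : Vec N → ℝ) n j, ∫ y in Ω, F y n j * h y = -∫ y in Ω, F y j n * h y := by
    intro h n j
    rw [← integral_neg]
    refine integral_congr_ae ?_
    filter_upwards [hskew] with y hy
    rw [hy n j, neg_mul]
  have hweak : ∀ n j i φ, IsTestFunction Ω φ → ∫ y in Ω, F y n j * pderiv i φ y = 0 := by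
    intro n j i φ hφ
    have hs (n i j : Fin N) : ∫ y in Ω, F y n j * pderiv i φ y = ∫ y in Ω, F y n i * pderiv j φ y :=
      hcurl n Ω hΩ (by simp [hΩ.inter_frontier_eq]) φ hφ i j
    -- An expression skew in its first two indices and symmetric in its last two vanishes:
    -- alternating the two symmetries six times returns it with the opposite sign.
    linarith [hanti (pderiv i φ) n j, hs j i n, hanti (pderiv n φ) j i, hs i n j,
      hanti (pderiv j φ) i n, hs n j i]
  choose A hA using fun n j => ae_eq_const_of_weak_grad_eq_zero hΩ hc (hF (n, j)) (hweak n j)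
  have hA' : ∀ᵐ y ∂volume.restrict Ω, ∀ n j, F y n j = A n j :=
    ae_all_iff.2 fun n => ae_all_iff.2 fun j => hA n j
  have hAskew : ∀ n j, A n j = -A j n := by
    have hne : NeBot (ae (volume.restrict Ω)) := by
      rw [ae_neBot, Ne, Measure.restrict_eq_zero]
      exact (hΩ.measure_pos volume hc.nonempty).ne'
    obtain ⟨y, hy, hy'⟩ := (hskew.and hA').exists
    intro n j
    rw [← hy', ← hy', hy]
  obtain ⟨U, hU, rfl⟩ := hΓt
  obtain ⟨φ, hφ, i, hi⟩ := exists_testFunction_integral_pderiv_ne_zero hΩ hx.2 hchart hU hx.1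
  -- With b = ∫_Ω ∇φ, this says that each row of A is parallel to b.
  have hcross : ∀ n i j, A n j * ∫ y in Ω, pderiv i φ y = A n i * ∫ y in Ω, pderiv j φ y := by
    intro n i j
    have h (i j : Fin N) :
        ∫ y in Ω, row F n y j * pderiv i φ y = A n j * ∫ y in Ω, pderiv i φ y := by
      rw [← integral_const_mul]
      refine integral_congr_ae ?_
      filter_upwards [hA'] with y hy
      rw [← hy, row]
    rw [← h, ← h]
    exact hcurl n U hU subset_rfl φ hφ i j
  -- If A m n ≠ 0, row n with its zero diagonal entry gives b_n = 0; then row m gives A m n · b_i =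
  -- A m i · b_n = 0, contrary to b_i ≠ 0.
  have hA0 : ∀ m n, A m n = 0 := by
    intro m n
    by_contra hmn
    have hmm : A m m = 0 := by linarith [hAskew m m]
    have hnn : A n n = 0 := by linarith [hAskew n n]
    have hm : ∫ y in Ω, pderiv m φ y = 0 := by
      have := hcross m m n
      rw [hmm, zero_mul] at this
      exact (mul_eq_zero.1 this).resolve_left hmn
    have hn : ∫ y in Ω, pderiv n φ y = 0 := by
      have := hcross n m n
      rw [hnn, zero_mul, hAskew n m] at this
      exact (mul_eq_zero.1 this.symm).resolve_left (neg_ne_zero.2 hmn)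
    have := hcross m i n
    rw [hn, mul_zero] at this
    exact (mul_eq_zero.1 this).elim hmn hi
  rw [l2Norm_eq_zero_iff hF]
  filter_upwards [hA'] with y hy
  ext p
  simp [entries, hy, hA0]

end Boundary

end KornTangential

/-! ### Contradiction and passage to the limit. -/

theorem lemma3p2 (N : ℕ) (Ω Γt : Set (Vec N))
    (hΩ : IsBoundedDomain Ω)
    (hΓt : IsRelOpenBdry Ω Γt)
    (hLip : ∀ x ∈ Γt, HasLipschitzChartAt Ω x)
    (hslice : Sliceable Ω Γt)
    (hne : Γt.Nonempty)
    (c_ks : ℝ) (hc_ks : 0 < c_ks) :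
    ∃ c_kt : ℝ, c_ks ≤ c_kt ∧
      ∀ (v : Vec N → Fin N → ℝ) (G : Vec N → Ten N),
        IsH1Vec Ω v G → IsHCurlZeroCirc Ω Γt G →
          l2Norm Ω (entries G) ≤ c_kt * l2Norm Ω (entries (symPart G)) := by
  obtain ⟨hopen, hconn, hbdd⟩ := hΩ
  obtain ⟨x, hx⟩ := hne
  obtain ⟨J, P, hPsub, hPnull, hPdisj, hP⟩ := hslice
  by_contra! hcon
  -- The constants c_ks + k + 1 are admissible, being at least c_ks, and unbounded, which forces the
  -- normalised strains to zero.
  choose v G hv hcirc hlt using fun k : ℕ =>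
    hcon (c_ks + (k + 1)) (le_add_of_nonneg_right (by positivity))
  let a : ℕ → ℝ := fun k => l2Norm Ω (entries (G k))
  have ha : ∀ k, 0 < a k := fun k =>
    lt_of_le_of_lt (mul_nonneg (by positivity) (l2Norm_nonneg _)) (hlt k)
  let T : ℕ → Vec N → Ten N := fun k y => (a k)⁻¹ • G k y
  have hvT : ∀ k, IsH1Vec Ω (fun y => (a k)⁻¹ • v k y) (T k) := fun k => (hv k).const_smul _
  have hT1 : ∀ k, l2Norm Ω (entries (T k)) = 1 := fun k => by
    have e := l2Norm_const_smul (Ω := Ω) (a k)⁻¹ (entries (G k))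
    rw [abs_of_pos (inv_pos.2 (ha k))] at e
    exact e.trans (inv_mul_cancel₀ (ha k).ne')
  have hTsym : Tendsto (fun k => l2Norm Ω (entries (symPart (T k)))) atTop (𝓝 0) := by
    refine squeeze_zero (fun _ => l2Norm_nonneg _) (fun k => ?_)
      tendsto_one_div_add_atTop_nhds_zero_nat
    rw [entries_symPart_const_smul, l2Norm_const_smul, abs_of_pos (inv_pos.2 (ha k)),
      le_div_iff₀ (by positivity), mul_assoc, inv_mul_le_iff₀ (ha k), mul_one, mul_comm]
    refine le_trans (mul_le_mul_of_nonneg_right ?_ (l2Norm_nonneg _)) (hlt k).le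
    linarith
  have hfin : ∀ j, volume (P j) ≠ ⊤ := fun j => (hbdd.subset (hPsub j)).measure_lt_top.ne
  have hPconn : ∀ j, IsConnected (P j) := fun j => by
    have := (hP j).2.1
    exact isConnected_iff_connectedSpace.2 inferInstance
  have hvP : ∀ j k, IsH1Vec (P j) (fun y => (a k)⁻¹ • v k y) (T k) := fun j k n =>
    (hvT k n).mono (hPsub j) hopen.measurableSet
  -- One subsequence serves all pieces, because there are finitely many and the Cauchy property
  -- passes to subsequences.
  obtain ⟨s, hs, hcau⟩ := exists_common_subsequence
    (fun (j : Fin J) (s : ℕ → ℕ) => CauchyL2 (P j) fun k => entries (T (s k)))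
    (fun j s t ht h => h.comp_strictMono ht)
    (fun j s hs => exists_cauchyL2_subsequence (hP j).1 (hPconn j) (hfin j) (hP j).2.2.1
      (fun k => hvP j (s k)) (M := 1)
      (fun k => (l2Norm_mono_set (hPsub j) (hvT (s k)).entries_memL2).trans (hT1 (s k)).le)
      (squeeze_zero (fun _ => l2Norm_nonneg _)
        (fun k => l2Norm_mono_set (hPsub j) (entries_symPart_memL2 (hvT (s k)).entries_memL2))
        (hTsym.comp hs.tendsto_atTop)))
  obtain ⟨f, hf, hlim⟩ := (cauchyL2_of_pieces hPsub (fun j => (hP j).1) hPnull hPdisj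
    (fun k => (hvT (s k)).entries_memL2) hcau).exists_tendsto fun k => (hvT (s k)).entries_memL2
  let F : Vec N → Ten N := fun y n j => f y (n, j)
  have hF : MemL2 Ω (entries F) := hf
  have hrow : ∀ n, MemL2 Ω (row F n) := fun n j => hf (n, j)
  have hFcurl : ∀ n, IsCurlFreeAcross Ω Γt (row F n) := fun n =>
    isCurlFreeAcross_of_tendsto
      (fun k => ((hcirc (s k) n).isCurlFreeAcross hopen).const_smul (a (s k))⁻¹)
      (fun k => (hvT (s k) n).grad_memL2) (hrow n)
      (squeeze_zero (fun _ => l2Norm_nonneg _)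
        (fun k => l2Norm_row_le (G := fun y => T (s k) y - F y)
          ((hvT (s k)).entries_memL2.sub hF) n) hlim)
  -- Taking symmetric parts does not increase the norm, so the strain of the limit is the limit of
  -- the strains.
  have hFsym : l2Norm Ω (entries (symPart F)) = 0 := by
    refine le_antisymm ?_ (l2Norm_nonneg _)
    refine ge_of_tendsto (by simpa using (hTsym.comp hs.tendsto_atTop).add hlim)
      (Eventually.of_forall fun k => ?_)
    have h1 := abs_l2Norm_sub_le (entries_symPart_memL2 (hvT (s k)).entries_memL2)
      (entries_symPart_memL2 hF)
    rw [← entries_symPart_sub] at h1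
    have h2 := h1.trans (l2Norm_symPart_le (G := fun y => T (s k) y - F y)
      ((hvT (s k)).entries_memL2.sub hF))
    have h3 : l2Norm Ω (entries fun y => T (s k) y - F y) =
      l2Norm Ω (fun y => entries (T (s k)) y - f y) := rfl
    have h4 := (abs_le.1 h2).1
    linarith
  have hF0 := l2Norm_entries_eq_zero hopen hconn hΓt hx (hLip x hx) hF hFcurl hFsym
  have : (1 : ℝ) ≤ 0 := by
    refine ge_of_tendsto hlim (Eventually.of_forall fun k => ?_)
    have h := abs_l2Norm_sub_le (hvT (s k)).entries_memL2 hF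
    rwa [hT1, hF0, sub_zero, abs_one] at h
  linarith
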